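/- Let $D\ge 1$ be an integer. For $g>0$ and $\ell\ge 0$ let $\chi'^2_g(\ell)$ denote the non-central chi-squared distribution with $g$ degrees of freedom and non-centrality parameter $\ell$, i.e. the law of a random variable $Y'$ such that, for some $M\sim\mathrm{Poisson}(\ell/2)$, the conditional law of $Y'$ given $M$ is $\chi^2_{g+2M}$. For $\alpha=(\alpha_1,\dots,\alpha_{D+1})$ with all $\alpha_i>0$ and $\lambda=(\lambda_1,\dots,\lambda_{D+1})$ with all $\lambda_i\ge 0$, let $Y'_1,\dots,Y'_{D+1}$ be independent with $Y'_i\sim\chi'^2_{2\alpha_i}(\lambda_i)$, let $Y'^+=\sum_{i=1}^{D+1}Y'_i$, and let $\mathrm{CNcDir}^D(\alpha,\lambda)$ (the $D$-variate Conditional Non-central Dirichlet distribution) be the conditional distribution of $\left(Y'_1/Y'^+,\dots,Y'_D/Y'^+\right)$ given $Y'^+=1$. Here the conditional distribution is the one with density $x\mapsto f(x,1)/\int f(u,1)\,du$, where $f$ is the version of the joint density of $\left(\left(Y'_1/Y'^+,\dots,Y'_D/Y'^+\right),Y'^+\right)$ that is continuous on $\mathcal S^D\times(0,\infty)$ and zero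 elsewhere, with $\mathcal S^D=\{x\in\mathbb R^D: 0<x_i<1 \text{ for all } i,\ \sum_{i=1}^D x_i<1\}$. **Proposition (Identifiability).** Let $\alpha,\tilde\alpha\in(0,\infty)^{D+1}$ and $\lambda,\tilde\lambda\in[0,\infty)^{D+1}$. Then $\mathrm{CNcDir}^D(\alpha,\lambda)=\mathrm{CNcDir}^D(\tilde\alpha,\tilde\lambda)$ if and only if $\alpha=\tilde\alpha$ and $\lambda=\tilde\lambda$. -/

import Mathlib

open MeasureTheory ProbabilityTheory Set

noncomputable section

/-- The chi-squared distribution with `g` degrees of freedom, i.e. the Gamma distribution with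
shape `g / 2` and rate `1 / 2`. -/
def chiSq (g : ℝ) : Measure ℝ :=
  gammaMeasure (g / 2) (1 / 2)

/-- The non-central chi-squared distribution with `g > 0` degrees of freedom and non-centrality
parameter `l ≥ 0`: the law of `Y'`, where `M` is Poisson with mean `l / 2` and `Y'` given `M = m`
is chi-squared with `g + 2 m` degrees of freedom. -/
def ncChiSq (g l : ℝ) : Measure ℝ :=
  (poissonMeasure (l / 2).toNNReal).bind fun m : ℕ => chiSq (g + 2 * (m : ℝ))

/-- The open unit simplex in `ℝ ^ D`. -/
def openSimplex (D : ℕ) : Set (Fin D → ℝ) :=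
  {x | (∀ i, 0 < x i ∧ x i < 1) ∧ ∑ i, x i < 1}

/-- `f` is a Lebesgue density of `ν` that vanishes off `U` and is continuous on `U`. For open `U`
there is at most one such `f`. -/
structure IsContinuousDensity {E : Type*} [TopologicalSpace E] [MeasureSpace E]
    (ν : Measure E) (U : Set E) (f : E → ℝ) : Prop where
  nonneg : ∀ z, 0 ≤ f z
  eq_zero : ∀ z, z ∉ U → f z = 0
  continuousOn : ContinuousOn f U
  eq_withDensity : ν = volume.withDensity fun z => ENNReal.ofReal (f z)

open Classical in
/-- Let `ν` be the joint law of a pair `(X, Y)`, with `Y` real, whose density `f` is continuous on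
the open set `U` that carries `ν`. This is the conditional distribution of `X` given `Y = y`, the
one with density `x ↦ f (x, y) / ∫ f (x', y) dx'`. (It is `0` if there is no such `f`.) -/
def condLawAt {E : Type*} [TopologicalSpace E] [MeasureSpace E]
    (ν : Measure (E × ℝ)) (U : Set (E × ℝ)) (y : ℝ) : Measure E :=
  if h : ∃ f : E × ℝ → ℝ, IsContinuousDensity ν U f then
    (∫⁻ x, ENNReal.ofReal (h.choose (x, y)))⁻¹ •
      (volume : Measure E).withDensity fun x => ENNReal.ofReal (h.choose (x, y))
  else 0

/-- The joint law of `((Y'₁ / Y'⁺, …, Y'_D / Y'⁺), Y'⁺)`, where `Y'₁, …, Y'_{D+1}` are independent,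
`Y'ᵢ` is non-central chi-squared with `2 αᵢ` degrees of freedom and non-centrality `lamᵢ`, and
`Y'⁺ = Y'₁ + ⋯ + Y'_{D+1}`. -/
def ncDirJoint (D : ℕ) (α lam : Fin (D + 1) → ℝ) : Measure ((Fin D → ℝ) × ℝ) :=
  (Measure.pi fun i => ncChiSq (2 * α i) (lam i)).map fun Y : Fin (D + 1) → ℝ =>
    ((fun i : Fin D => Y i.castSucc / ∑ j, Y j), ∑ j, Y j)

/-- The `D`-variate Conditional Non-central Dirichlet distribution: the conditional distribution
of `(Y'₁ / Y'⁺, …, Y'_D / Y'⁺)` given `Y'⁺ = 1`. -/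
def cncDir (D : ℕ) (α lam : Fin (D + 1) → ℝ) : Measure (Fin D → ℝ) :=
  condLawAt (ncDirJoint D α lam) (openSimplex D ×ˢ Ioi 0) 1

end

open Filter Topology
open scoped ENNReal

/-! Write φ_a(z) = ∑ zᵐ / (m! Γ(a + m)). Summing the Poisson mixture gives Y'ᵢ a density
proportional to y^(αᵢ-1) e^(-y/2) φ_{αᵢ}(λᵢ y / 4). On Y'⁺ = 1 the exponentials multiply to a
constant, so in barycentric coordinates the conditional density is proportional to ∏ xᵢ^(αᵢ-1)
φ_{αᵢ}(λᵢ xᵢ / 4). Equality of two such laws makes these continuous products proportional on the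
whole simplex (`exists_proportional_of_cncDir_eq`).

Freeze all coordinates but two, t and σ - t. The behaviour as t → 0⁺ determines αᵢ
(`exponent_eq_of_two_factor`). Once the powers cancel, the remaining identity is between analytic
functions of t and extends to negative t. There φ_a has a zero -y of smallest modulus
(`exists_besselSeries_zero`), and the position -y/l of the first zero of φ_a(l t) determines the
scale l (`besselSeries_scale_le`). -/

/-! ### The entire function φ_a and its negative zeros. -/

/-- The coefficients `1 / (m! Γ(a + m))`. -/
noncomputable def besselCoeff (a : ℝ) (m : ℕ) : ℝ :=
  ((m.factorial : ℝ) * Real.Gamma (a + m))⁻¹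

/-- The modified Bessel type series `∑ zᵐ / (m! Γ(a + m))`. -/
noncomputable def besselSeries (a z : ℝ) : ℝ :=
  ∑' m : ℕ, besselCoeff a m * z ^ m

lemma besselCoeff_pos {a : ℝ} (ha : 0 < a) (m : ℕ) : 0 < besselCoeff a m := by
  have := Real.Gamma_pos_of_pos (show 0 < a + m by positivity)
  unfold besselCoeff
  positivity

lemma besselCoeff_succ {a : ℝ} (ha : 0 < a) (m : ℕ) :
    besselCoeff a (m + 1) = besselCoeff a m / ((m + 1) * (a + m)) := by
  have h : 0 < a + m := by positivity
  have := Real.Gamma_pos_of_pos h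
  unfold besselCoeff
  rw [Nat.factorial_succ, Nat.cast_succ, ← add_assoc, Real.Gamma_add_one h.ne']
  push_cast
  field_simp

lemma besselCoeff_succ_mul {a : ℝ} (ha : 0 < a) (m : ℕ) :
    besselCoeff a (m + 1) * (m + 1) = besselCoeff (a + 1) m := by
  have h : 0 < a + m := by positivity
  have := Real.Gamma_pos_of_pos h
  unfold besselCoeff
  rw [Nat.factorial_succ, Nat.cast_succ, ← add_assoc, show a + 1 + m = a + m + 1 by ring,
    Real.Gamma_add_one h.ne']
  push_cast
  field_simp

lemma radius_besselCoeff {a : ℝ} (ha : 0 < a) :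
    (FormalMultilinearSeries.ofScalars ℝ (besselCoeff a)).radius = ⊤ := by
  refine FormalMultilinearSeries.ofScalars_radius_eq_top_of_tendsto _ _
    (Eventually.of_forall fun m => (besselCoeff_pos ha m).ne') ?_
  have h : ∀ m : ℕ, ‖besselCoeff a m.succ‖ / ‖besselCoeff a m‖ ≤ a⁻¹ * (1 / ((m : ℝ) + 1)) := by
    intro m
    rw [Real.norm_of_nonneg (besselCoeff_pos ha _).le,
      Real.norm_of_nonneg (besselCoeff_pos ha _).le, Nat.succ_eq_add_one, besselCoeff_succ ha]
    have := besselCoeff_pos ha m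
    rw [div_div_cancel_left' this.ne', one_div, ← mul_inv, mul_comm]
    gcongr
    simp
  refine squeeze_zero (fun m => by positivity) h ?_
  simpa using tendsto_one_div_add_atTop_nhds_zero_nat.const_mul a⁻¹

lemma besselSeries_eq_ofScalarsSum (a : ℝ) :
    besselSeries a = FormalMultilinearSeries.ofScalarsSum (besselCoeff a) := by
  rw [FormalMultilinearSeries.ofScalarsSum_eq_tsum]
  rfl

lemma analyticOnNhd_besselSeries {a : ℝ} (ha : 0 < a) :
    AnalyticOnNhd ℝ (besselSeries a) univ := by
  have h := (FormalMultilinearSeries.ofScalars ℝ (besselCoeff a)).hasFPowerSeriesOnBall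
    (by rw [radius_besselCoeff ha]; simp)
  rw [besselSeries_eq_ofScalarsSum]
  intro z _
  refine h.analyticOnNhd z ?_
  rw [radius_besselCoeff ha]
  simp

lemma summable_besselSeries {a : ℝ} (ha : 0 < a) (z : ℝ) :
    Summable fun m : ℕ => besselCoeff a m * z ^ m := by
  have h := (FormalMultilinearSeries.ofScalars ℝ (besselCoeff a)).hasFPowerSeriesOnBall
    (by rw [radius_besselCoeff ha]; simp)
  have := (h.hasSum (y := z) (by rw [radius_besselCoeff ha]; simp)).summable
  simpa [FormalMultilinearSeries.ofScalars_apply_eq, mul_comm] using this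

lemma hasDerivAt_besselSeries {a : ℝ} (ha : 0 < a) (z : ℝ) :
    HasDerivAt (besselSeries a) (besselSeries (a + 1) z) z := by
  have ha1 : 0 < a + 1 := by positivity
  set R : ℝ := |z| + 1 with hR
  have hR0 : 0 < R := by positivity
  -- The term n = 0 vanishes despite the truncated exponent; shifting the index leaves the series of
  -- φ_{a+1} at R.
  have hu : Summable fun n : ℕ => besselCoeff a n * (n * R ^ (n - 1)) := by
    rw [← summable_nat_add_iff 1]
    refine (summable_besselSeries ha1 R).congr fun n => ?_
    rw [← besselCoeff_succ_mul ha]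
    push_cast
    ring
  have key := hasDerivAt_tsum_of_isPreconnected (g := fun n y => besselCoeff a n * y ^ n)
    (g' := fun n y => besselCoeff a n * (n * y ^ (n - 1)))
    (t := Metric.ball (0 : ℝ) R) (y₀ := z) (y := z) hu
    Metric.isOpen_ball (convex_ball 0 R).isPreconnected
    (fun n y _ => (hasDerivAt_pow n y).const_mul _)
    (fun n y hy => by
      have hy' : |y| ≤ R := by simpa using (Metric.mem_ball.1 hy).le
      rw [norm_mul, norm_mul, norm_pow, Real.norm_of_nonneg (besselCoeff_pos ha n).le,
        Real.norm_of_nonneg (Nat.cast_nonneg n), Real.norm_eq_abs]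
      have := besselCoeff_pos ha n
      gcongr)
    (by simp [hR]) (summable_besselSeries ha z) (by simp [hR])
  refine key.congr_deriv ?_
  rw [Summable.tsum_eq_zero_add]
  · simp only [besselSeries, ← besselCoeff_succ_mul ha]
    simp
    exact tsum_congr fun n => by ring
  · rw [← summable_nat_add_iff 1]
    refine (summable_besselSeries ha1 z).congr fun n => ?_
    rw [← besselCoeff_succ_mul ha]
    push_cast
    ring

/-- The recurrence `φ_a = a φ_{a+1} + z φ_{a+2}`. -/
lemma besselSeries_recurrence {a : ℝ} (ha : 0 < a) (z : ℝ) :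
    besselSeries a z = a * besselSeries (a + 1) z + z * besselSeries (a + 1 + 1) z := by
  have ha1 : 0 < a + 1 := by positivity
  have ha2 : 0 < a + 1 + 1 := by positivity
  -- The coefficients satisfy c_a(n) = (a + n) c_{a+1}(n); the part carrying the factor n sums,
  -- after a shift, to z φ_{a+2}(z).
  have h2 : HasSum (fun n : ℕ => besselCoeff (a + 1) n * n * z ^ n)
      (z * besselSeries (a + 1 + 1) z) := by
    rw [← hasSum_nat_add_iff' 1]
    simp only [Finset.range_one, Finset.sum_singleton, CharP.cast_eq_zero, mul_zero, zero_mul,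
      sub_zero]
    refine ((summable_besselSeries ha2 z).hasSum.mul_left z).congr_fun ?_
    intro n
    rw [← besselCoeff_succ_mul ha1]
    push_cast
    ring
  have h1 := ((summable_besselSeries ha1 z).hasSum.mul_left a).add h2
  rw [← show _ = a * besselSeries (a + 1) z + z * besselSeries (a + 1 + 1) z from h1.tsum_eq]
  refine tsum_congr fun n => ?_
  have h : 0 < a + n := by positivity
  have := Real.Gamma_pos_of_pos h
  unfold besselCoeff
  rw [show a + 1 + n = a + n + 1 by ring, Real.Gamma_add_one h.ne']
  field_simp

lemma besselSeries_pos {a z : ℝ} (ha : 0 < a) (hz : 0 ≤ z) : 0 < besselSeries a z :=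
  (summable_besselSeries ha z).tsum_pos
    (fun m => mul_nonneg (besselCoeff_pos ha m).le (pow_nonneg hz m)) 0
    (by simpa using besselCoeff_pos ha 0)

lemma continuous_besselSeries {a : ℝ} (ha : 0 < a) : Continuous (besselSeries a) :=
  continuous_iff_continuousAt.2 fun z => (hasDerivAt_besselSeries ha z).continuousAt

/-- A Riccati argument. With u(y) = φ_a(-y) and v(y) = φ_{a+1}(-y) one has u' = -v and y v' = u - a
v. If u stayed positive, so would v, and -u/v would be negative while growing at least like y/2,
which is absurd. -/
lemma exists_besselSeries_nonpos {a : ℝ} (ha : 0 < a) : ∃ y, 0 < y ∧ besselSeries a (-y) ≤ 0 := by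
  by_contra! hpos
  have ha1 : 0 < a + 1 := by positivity
  set u : ℝ → ℝ := fun y => besselSeries a (-y) with hu
  set v : ℝ → ℝ := fun y => besselSeries (a + 1) (-y) with hv
  have hu' : ∀ y, HasDerivAt u (-v y) y := fun y => by
    simpa [hu, hv, Function.comp_def] using
      (hasDerivAt_besselSeries ha (-y)).comp y (hasDerivAt_neg y)
  have hv' : ∀ y, HasDerivAt v (-besselSeries (a + 1 + 1) (-y)) y := fun y => by
    simpa [hu, hv, Function.comp_def] using
      (hasDerivAt_besselSeries ha1 (-y)).comp y (hasDerivAt_neg y)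
  have hv'' : ∀ y, 0 < y → HasDerivAt v ((u y - a * v y) / y) y := fun y hy => by
    refine (hv' y).congr_deriv ?_
    have := besselSeries_recurrence ha (-y)
    simp only [hu, hv]
    field_simp
    linarith
  have hu0 : ∀ y, 0 < y → 0 < u y := hpos
  have hv0 : ∀ y, 0 < y → 0 < v y := by
    -- The integrating factor y^a removes the term -a v / y.
    have hd : ∀ y, 0 < y → HasDerivAt (fun y => y ^ a * v y) (y ^ (a - 1) * u y) y := fun y hy => by
      refine ((Real.hasDerivAt_rpow_const (p := a) (Or.inl hy.ne')).mul (hv'' y hy)).congr_deriv ?_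
      rw [show y ^ a = y ^ (a - 1) * y by rw [← Real.rpow_add_one hy.ne']; simp]
      field_simp
      ring
    have hmono : StrictMonoOn (fun y => y ^ a * v y) (Ici 0) := by
      refine strictMonoOn_of_deriv_pos (convex_Ici 0) ?_ ?_
      · exact ((Real.continuous_rpow_const ha.le).mul
          ((continuous_besselSeries ha1).comp continuous_neg)).continuousOn
      · intro y hy
        rw [interior_Ici] at hy
        rw [(hd y hy).deriv]
        exact mul_pos (Real.rpow_pos_of_pos hy _) (hu0 y hy)
    intro y hy
    have := hmono (mem_Ici.2 le_rfl) (mem_Ici.2 hy.le) hy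
    simp only [Real.zero_rpow ha.ne', zero_mul] at this
    exact (mul_pos_iff_of_pos_left (Real.rpow_pos_of_pos hy _)).1 this
  set q : ℝ → ℝ := fun y => -(u y / v y) - y / 2 with hq
  have hqd : ∀ y, 0 < y → HasDerivAt q
      (-((-v y * v y - u y * ((u y - a * v y) / y)) / v y ^ 2) - 1 / 2) y := fun y hy =>
    (((hu' y).div (hv'' y hy) (hv0 y hy).ne').neg).sub ((hasDerivAt_id y).div_const 2)
  -- Beyond a² the numerator of q', written as a sum of squares plus (y - a²) v², is nonnegative.
  set y₀ : ℝ := a ^ 2 with hy₀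
  have hy₀0 : 0 < y₀ := by positivity
  have hqmono : MonotoneOn q (Ici y₀) := by
    refine monotoneOn_of_deriv_nonneg (convex_Ici _)
      (fun y hy => (hqd y (hy₀0.trans_le hy)).continuousAt.continuousWithinAt) ?_ ?_
    · intro y hy
      rw [interior_Ici] at hy
      exact (hqd y (hy₀0.trans hy)).differentiableAt.differentiableWithinAt
    · intro y hy
      rw [interior_Ici] at hy
      have hy0 : 0 < y := hy₀0.trans hy
      rw [(hqd y hy0).deriv]
      have h1 := hv0 y hy0
      rw [show -((-v y * v y - u y * ((u y - a * v y) / y)) / v y ^ 2) - 1 / 2 =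
        ((u y - a * v y) ^ 2 + u y ^ 2 + (y - a ^ 2) * v y ^ 2) / (2 * y * v y ^ 2) by
          field_simp; ring]
      have : 0 ≤ y - a ^ 2 := (sub_pos.2 hy).le
      positivity
  have hq0 : ∀ y, 0 < y → q y < -(y / 2) := fun y hy => by
    have := div_pos (hu0 y hy) (hv0 y hy)
    simp only [hq]
    linarith
  -- Far enough out that q(Y) < -Y/2 < q(y₀), against monotonicity.
  set Y : ℝ := y₀ + 2 * |q y₀| with hY
  have hYy : y₀ ≤ Y := by simp [hY]
  have h1 := hqmono (mem_Ici.2 le_rfl) (mem_Ici.2 hYy) hYy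
  have h2 := hq0 Y (hy₀0.trans_le hYy)
  have h3 := neg_abs_le (q y₀)
  linarith

/-- `φ_a` has a zero of smallest modulus on the negative half-line. -/
lemma exists_besselSeries_zero {a : ℝ} (ha : 0 < a) :
    ∃ y, 0 < y ∧ besselSeries a (-y) = 0 ∧ ∀ t, 0 ≤ t → t < y → 0 < besselSeries a (-t) := by
  obtain ⟨Y, hY, hYn⟩ := exists_besselSeries_nonpos ha
  have hc : Continuous fun t : ℝ => besselSeries a (-t) :=
    (continuous_besselSeries ha).comp continuous_neg
  -- The zero is the infimum of S: the value there is ≤ 0 since S is closed, and ≥ 0 as a limit of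
  -- positive values from the left.
  set S : Set ℝ := {t | 0 ≤ t ∧ besselSeries a (-t) ≤ 0} with hS
  have hSc : IsClosed S := isClosed_Ici.inter (isClosed_le hc continuous_const)
  have hSne : S.Nonempty := ⟨Y, hY.le, hYn⟩
  have hSb : BddBelow S := ⟨0, fun t ht => ht.1⟩
  have hmem : sInf S ∈ S := hSc.csInf_mem hSne hSb
  have hlt : ∀ t, 0 ≤ t → t < sInf S → 0 < besselSeries a (-t) := fun t ht hts => by
    by_contra! h
    exact absurd (csInf_le hSb ⟨ht, h⟩) (not_le.2 hts)
  have hpos : 0 < sInf S := by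
    refine hmem.1.lt_of_ne fun h => ?_
    have h2 := hmem.2
    rw [← h, neg_zero] at h2
    exact absurd (besselSeries_pos ha le_rfl) (not_lt.2 h2)
  refine ⟨sInf S, hpos, le_antisymm hmem.2 ?_, hlt⟩
  refine ge_of_tendsto (hc.continuousAt.continuousWithinAt (s := Iio (sInf S))).tendsto ?_
  filter_upwards [Ioo_mem_nhdsLT hpos] with t ht
  exact (hlt t ht.1.le ht.2).le

/-! ### Recovering exponent and scale from a two-factor product. -/

/-- Taking logarithms, p - q = (log G - log F) / log t, whose numerator converges while log t → -∞.
-/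
lemma rpow_exponent_eq_of_mul_eq {p q : ℝ} {F G : ℝ → ℝ} (hF : ContinuousAt F 0)
    (hG : ContinuousAt G 0) (hF0 : 0 < F 0) (hG0 : 0 < G 0)
    (h : ∀ᶠ t in 𝓝[>] (0 : ℝ), t ^ p * F t = t ^ q * G t) : p = q := by
  have hlim : Tendsto (fun t => (Real.log (G t) - Real.log (F t)) / Real.log t)
      (𝓝[>] (0 : ℝ)) (𝓝 0) :=
    (((hG.log hG0.ne').tendsto.sub (hF.log hF0.ne').tendsto).mono_left
      nhdsWithin_le_nhds).div_atBot Real.tendsto_log_nhdsGT_zero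
  have hconst : (fun t => (Real.log (G t) - Real.log (F t)) / Real.log t)
      =ᶠ[𝓝[>] (0 : ℝ)] fun _ => p - q := by
    filter_upwards [h, (hF.eventually (lt_mem_nhds hF0)).filter_mono nhdsWithin_le_nhds,
      (hG.eventually (lt_mem_nhds hG0)).filter_mono nhdsWithin_le_nhds,
      Ioo_mem_nhdsGT (zero_lt_one' ℝ)] with t ht hFt hGt ht1
    have h1 := congrArg Real.log ht
    rw [Real.log_mul (Real.rpow_pos_of_pos ht1.1 _).ne' hFt.ne',
      Real.log_mul (Real.rpow_pos_of_pos ht1.1 _).ne' hGt.ne', Real.log_rpow ht1.1,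
      Real.log_rpow ht1.1] at h1
    have := Real.log_neg ht1.1 ht1.2
    rw [div_eq_iff this.ne]
    linarith
  have := tendsto_nhds_unique (hlim.congr' hconst) tendsto_const_nhds
  linarith

lemma besselSeries_scale_le {a b l l' m m' σ K : ℝ} (ha : 0 < a) (hb : 0 < b)
    (hl' : 0 ≤ l') (hm' : 0 ≤ m') (hσ : 0 < σ) (hK : K ≠ 0)
    (h : ∀ t ∈ Ioo 0 σ, besselSeries a (l * t) * besselSeries b (m * (σ - t)) =
      K * (besselSeries a (l' * t) * besselSeries b (m' * (σ - t)))) : l ≤ l' := by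
  by_contra! hlt
  have hl0 : 0 < l := hl'.trans_lt hlt
  have hid : AnalyticOnNhd ℝ (fun t : ℝ => t) univ := analyticOnNhd_id
  have hA : ∀ {c : ℝ} (k : ℝ), 0 < c → AnalyticOnNhd ℝ (fun t => besselSeries c (k * t)) univ :=
    fun k hc => (analyticOnNhd_besselSeries hc).comp (analyticOnNhd_const.mul hid)
      (fun _ _ => mem_univ _)
  have hB : ∀ {c : ℝ} (k : ℝ), 0 < c →
      AnalyticOnNhd ℝ (fun t => besselSeries c (k * (σ - t))) univ :=
    fun k hc => (analyticOnNhd_besselSeries hc).comp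
      (analyticOnNhd_const.mul (analyticOnNhd_const.sub hid)) (fun _ _ => mem_univ _)
  have heq : (fun t => besselSeries a (l * t) * besselSeries b (m * (σ - t))) =
      fun t => K * (besselSeries a (l' * t) * besselSeries b (m' * (σ - t))) :=
    AnalyticOnNhd.eq_of_eventuallyEq ((hA l ha).mul (hB m hb))
    (analyticOnNhd_const (v := K).mul ((hA l' ha).mul (hB m' hb))) (z₀ := σ / 2)
    (by
      filter_upwards [Ioo_mem_nhds (half_pos hσ) (half_lt_self hσ)] with t ht
      exact h t ht)
  obtain ⟨y, hy, hy0, hyt⟩ := exists_besselSeries_zero ha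
  -- Here the left side contains φ_a(-y) = 0. On the right, l' y / l < y lies before the first zero,
  -- and σ - t > 0 keeps the other factor positive.
  have := congrFun heq (-(y / l))
  beta_reduce at this
  rw [mul_neg, mul_div_cancel₀ _ hl0.ne', hy0, zero_mul] at this
  have h1 : 0 < besselSeries a (l' * -(y / l)) := by
    rw [mul_neg]
    refine hyt _ (by positivity) ?_
    rw [mul_div_assoc', div_lt_iff₀ hl0, mul_comm]
    gcongr
  have h2 : 0 < besselSeries b (m' * (σ - -(y / l))) := by
    rw [sub_neg_eq_add]
    exact besselSeries_pos hb (by positivity)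
  exact (mul_ne_zero hK (mul_pos h1 h2).ne') this.symm

lemma exponent_eq_of_two_factor {a a' b b' l l' m m' σ K : ℝ} (ha : 0 < a) (ha' : 0 < a')
    (hb : 0 < b) (hb' : 0 < b') (hm : 0 ≤ m) (hm' : 0 ≤ m') (hσ : 0 < σ) (hK : 0 < K)
    (h : ∀ t ∈ Ioo 0 σ,
      t ^ (a - 1) * besselSeries a (l * t) *
        ((σ - t) ^ (b - 1) * besselSeries b (m * (σ - t))) =
      K * (t ^ (a' - 1) * besselSeries a' (l' * t) *
        ((σ - t) ^ (b' - 1) * besselSeries b' (m' * (σ - t))))) : a = a' := by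
  have hc : ∀ {c d k n : ℝ}, 0 < c → 0 < d → ContinuousAt (fun t => besselSeries c (k * t) *
      ((σ - t) ^ (d - 1) * besselSeries d (n * (σ - t)))) 0 := fun {c d k n} hc hd => by
    have h1 : Continuous fun t => besselSeries c (k * t) :=
      (continuous_besselSeries hc).comp (by fun_prop)
    have h2 : Continuous fun t => besselSeries d (n * (σ - t)) :=
      (continuous_besselSeries hd).comp (by fun_prop)
    have h3 : ContinuousAt (fun t : ℝ => (σ - t) ^ (d - 1)) 0 :=
      ContinuousAt.rpow_const (by fun_prop) (Or.inl (by simpa using hσ.ne'))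
    exact h1.continuousAt.mul (h3.mul h2.continuousAt)
  have hp : ∀ {c d k n : ℝ}, 0 < c → 0 < d → 0 ≤ n → 0 < besselSeries c (k * 0) *
      ((σ - 0) ^ (d - 1) * besselSeries d (n * (σ - 0))) := fun {c d k n} hc hd hn => by
    rw [mul_zero, sub_zero]
    exact mul_pos (besselSeries_pos hc le_rfl)
      (mul_pos (Real.rpow_pos_of_pos hσ _) (besselSeries_pos hd (by positivity)))
  have := rpow_exponent_eq_of_mul_eq (p := a - 1) (q := a' - 1)
    (G := fun t => K * (besselSeries a' (l' * t) *
      ((σ - t) ^ (b' - 1) * besselSeries b' (m' * (σ - t)))))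
    (hc (k := l) (n := m) ha hb) (continuousAt_const (y := K).mul (hc (k := l') (n := m') ha' hb'))
    (hp ha hb hm) (mul_pos hK (hp ha' hb' hm')) (by
      filter_upwards [Ioo_mem_nhdsGT hσ] with t ht
      have := h t ht
      linarith)
  linarith

lemma parameters_eq_of_two_factor {a a' b b' l l' m m' σ K : ℝ} (ha : 0 < a) (ha' : 0 < a')
    (hb : 0 < b) (hb' : 0 < b') (hl : 0 ≤ l) (hl' : 0 ≤ l') (hm : 0 ≤ m) (hm' : 0 ≤ m')
    (hσ : 0 < σ) (hK : 0 < K)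
    (h : ∀ t ∈ Ioo 0 σ,
      t ^ (a - 1) * besselSeries a (l * t) *
        ((σ - t) ^ (b - 1) * besselSeries b (m * (σ - t))) =
      K * (t ^ (a' - 1) * besselSeries a' (l' * t) *
        ((σ - t) ^ (b' - 1) * besselSeries b' (m' * (σ - t))))) : a = a' ∧ l = l' := by
  have haa : a = a' := exponent_eq_of_two_factor ha ha' hb hb' hm hm' hσ hK h
  have hbb : b = b' := by
    -- The reflection t ↦ σ - t exchanges the two factors.
    refine exponent_eq_of_two_factor hb hb' ha ha' hl hl' hσ hK (l := m) (l' := m') fun t ht => ?_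
    have := h (σ - t) ⟨by linarith [ht.2], by linarith [ht.1]⟩
    rw [sub_sub_cancel] at this
    linarith
  subst haa hbb
  have h' : ∀ t ∈ Ioo 0 σ, besselSeries a (l * t) * besselSeries b (m * (σ - t)) =
      K * (besselSeries a (l' * t) * besselSeries b (m' * (σ - t))) := fun t ht => by
    have h1 := Real.rpow_pos_of_pos ht.1 (a - 1)
    have h2 := Real.rpow_pos_of_pos (sub_pos.2 ht.2) (b - 1)
    refine mul_left_cancel₀ (mul_pos h1 h2).ne' ?_
    linarith [h t ht]
  refine ⟨rfl, le_antisymm (besselSeries_scale_le ha hb hl' hm' hσ hK.ne' h')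
    (besselSeries_scale_le (K := K⁻¹) (m := m') ha hb hl hm hσ (inv_ne_zero hK.ne') fun t ht => ?_)⟩
  rw [h' t ht, inv_mul_cancel_left₀ hK.ne']

/-! ### The non-central chi-squared density. -/

/-- The density of `ncChiSq (2 * a) l`. -/
noncomputable def ncChiSqDensity (a l y : ℝ) : ℝ :=
  if 0 < y then
    Real.exp (-(l / 2)) * (1 / 2) ^ a * Real.exp (-(y / 2)) *
      (y ^ (a - 1) * besselSeries a (l / 4 * y))
  else 0

lemma ncChiSqDensity_of_pos {a l y : ℝ} (hy : 0 < y) : ncChiSqDensity a l y =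
    Real.exp (-(l / 2)) * (1 / 2) ^ a * Real.exp (-(y / 2)) *
      (y ^ (a - 1) * besselSeries a (l / 4 * y)) :=
  if_pos hy

lemma ncChiSqDensity_of_nonpos {a l y : ℝ} (hy : y ≤ 0) : ncChiSqDensity a l y = 0 :=
  if_neg hy.not_gt

lemma ncChiSqDensity_pos {a l y : ℝ} (ha : 0 < a) (hl : 0 ≤ l) (hy : 0 < y) :
    0 < ncChiSqDensity a l y := by
  rw [ncChiSqDensity_of_pos hy]
  have := besselSeries_pos ha (show 0 ≤ l / 4 * y by positivity)
  positivity

lemma ncChiSqDensity_nonneg {a l : ℝ} (ha : 0 < a) (hl : 0 ≤ l) (y : ℝ) :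
    0 ≤ ncChiSqDensity a l y := by
  rcases lt_or_ge 0 y with hy | hy
  · exact (ncChiSqDensity_pos ha hl hy).le
  · exact (ncChiSqDensity_of_nonpos hy).ge

lemma continuousOn_ncChiSqDensity {a : ℝ} (ha : 0 < a) (l : ℝ) :
    ContinuousOn (ncChiSqDensity a l) (Ioi 0) := by
  have h1 : Continuous fun y => besselSeries a (l / 4 * y) :=
    (continuous_besselSeries ha).comp (by fun_prop)
  have h2 : ContinuousOn (fun y : ℝ => y ^ (a - 1)) (Ioi 0) := fun y hy =>
    (Real.continuousAt_rpow_const y _ (Or.inl (ne_of_gt hy))).continuousWithinAt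
  have h3 : Continuous fun y : ℝ => Real.exp (-(l / 2)) * (1 / 2) ^ a * Real.exp (-(y / 2)) := by
    fun_prop
  exact (h3.continuousOn.mul (h2.mul h1.continuousOn)).congr
    fun y hy => ncChiSqDensity_of_pos hy

lemma measurable_ncChiSqDensity {a : ℝ} (ha : 0 < a) (l : ℝ) :
    Measurable (ncChiSqDensity a l) := by
  have h1 : Measurable fun y => besselSeries a (l / 4 * y) :=
    ((continuous_besselSeries ha).comp (by fun_prop)).measurable
  refine Measurable.ite measurableSet_Ioi ?_ measurable_const
  exact Measurable.mul (by fun_prop) (Measurable.mul (by fun_prop) h1)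

/-- The point y = 0 is excluded because `gammaPDF` need not vanish there (shape 1), whereas
`ncChiSqDensity` does. -/
lemma tsum_poisson_mul_gammaPDF {a l y : ℝ} (ha : 0 < a) (hl : 0 ≤ l) (hy : y ≠ 0) :
    ∑' m : ℕ, gammaPDF ((2 * a + 2 * m) / 2) (1 / 2) y * poissonMeasure (l / 2).toNNReal {m} =
      ENNReal.ofReal (ncChiSqDensity a l y) := by
  rcases hy.lt_or_gt with hy | hy
  · simp [gammaPDF_of_neg hy, ncChiSqDensity_of_nonpos hy.le]
  have key : ∀ m : ℕ,
      gammaPDF ((2 * a + 2 * m) / 2) (1 / 2) y * poissonMeasure (l / 2).toNNReal {m} =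
      ENNReal.ofReal (Real.exp (-(l / 2)) * (1 / 2) ^ a * Real.exp (-(y / 2)) * y ^ (a - 1) *
        (besselCoeff a m * (l / 4 * y) ^ m)) := by
    intro m
    have h : 0 < a + m := by positivity
    have hG := Real.Gamma_pos_of_pos h
    rw [gammaPDF_of_nonneg hy.le, poissonMeasure_singleton, Real.coe_toNNReal _ (by positivity),
      show (2 * a + 2 * (m : ℝ)) / 2 = a + m by ring, ← ENNReal.ofReal_mul (by positivity),
      show a + m - 1 = a - 1 + m by ring, Real.rpow_add_natCast hy.ne',
      Real.rpow_add_natCast (by norm_num), besselCoeff,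
      show l / 4 * y = l / 2 * (1 / 2) * y by ring, mul_pow, mul_pow,
      show -(1 / 2 * y) = -(y / 2) by ring]
    congr 1
    field_simp
  simp_rw [key]
  rw [← ENNReal.ofReal_tsum_of_nonneg, tsum_mul_left, ncChiSqDensity_of_pos hy]
  · rw [besselSeries]
    congr 1
    ring
  · intro m
    have := besselCoeff_pos ha m
    positivity
  · exact (summable_besselSeries ha _).mul_left _

lemma ncChiSq_eq_withDensity {a l : ℝ} (ha : 0 < a) (hl : 0 ≤ l) :
    ncChiSq (2 * a) l = volume.withDensity fun y => ENNReal.ofReal (ncChiSqDensity a l y) := by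
  ext s hs
  rw [ncChiSq, Measure.bind_apply hs (measurable_of_countable _).aemeasurable,
    lintegral_countable', withDensity_apply _ hs]
  simp_rw [chiSq, gammaMeasure, withDensity_apply _ hs]
  have hm : ∀ m : ℕ, Measurable (gammaPDF ((2 * a + 2 * m) / 2) (1 / 2)) :=
    fun m => (measurable_gammaPDFReal _ _).ennreal_ofReal
  simp_rw [← lintegral_mul_const _ (hm _)]
  rw [← lintegral_tsum fun m => ((hm m).mul_const _).aemeasurable]
  refine lintegral_congr_ae (ae_restrict_of_ae ?_)
  filter_upwards [compl_mem_ae_iff.2 (measure_singleton (μ := (volume : Measure ℝ)) 0)] with y hy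
  exact tsum_poisson_mul_gammaPDF ha hl hy

lemma isProbabilityMeasure_ncChiSq {a l : ℝ} (ha : 0 < a) :
    IsProbabilityMeasure (ncChiSq (2 * a) l) := by
  refine isProbabilityMeasure_bind (measurable_of_countable _).aemeasurable
    (ae_of_all _ fun m => ?_)
  exact isProbabilityMeasure_gammaMeasure (by positivity) (by norm_num)

/-! ### Product densities and changes of variables. -/

lemma lintegral_fin_pi_prod (n : ℕ) {f : Fin n → ℝ → ℝ≥0∞} (hf : ∀ i, Measurable (f i)) :
    ∫⁻ x : Fin n → ℝ, ∏ i, f i (x i) = ∏ i, ∫⁻ t, f i t := by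
  induction n with
  | zero => simp [lintegral_unique, volume_pi]
  | succ n ih =>
    rw [← (volume_preserving_piFinSuccAbove (fun _ : Fin (n + 1) => ℝ) 0).symm.lintegral_comp
      (by fun_prop), Fin.prod_univ_succ, ← ih fun i => hf i.succ, Measure.volume_eq_prod,
      ← lintegral_prod_mul (hf 0).aemeasurable (Finset.measurable_prod _ fun i _ =>
        (hf i.succ).comp (measurable_pi_apply i)).aemeasurable]
    refine lintegral_congr fun z => ?_
    rw [Fin.prod_univ_succ]
    simp [MeasurableEquiv.piFinSuccAbove, Fin.insertNthEquiv]

lemma pi_withDensity (n : ℕ) {f : Fin n → ℝ → ℝ≥0∞} (hf : ∀ i, Measurable (f i))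
    [∀ i, SigmaFinite (volume.withDensity (f i))] :
    Measure.pi (fun i => volume.withDensity (f i)) =
      volume.withDensity fun x : Fin n → ℝ => ∏ i, f i (x i) := by
  refine Measure.pi_eq fun s hs => ?_
  rw [withDensity_apply _ (MeasurableSet.univ_pi hs),
    ← lintegral_indicator (MeasurableSet.univ_pi hs)]
  simp_rw [withDensity_apply _ (hs _), ← lintegral_indicator (hs _)]
  rw [← lintegral_fin_pi_prod n fun i => (hf i).indicator (hs i)]
  refine lintegral_congr fun x => ?_
  by_cases hx : x ∈ univ.pi s
  · rw [indicator_of_mem hx]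
    exact Finset.prod_congr rfl fun i _ => (indicator_of_mem (hx i (mem_univ i)) _).symm
  · rw [indicator_of_notMem hx]
    obtain ⟨i, hi⟩ : ∃ i, x i ∉ s i := by simpa [mem_univ_pi] using hx
    exact (Finset.prod_eq_zero (Finset.mem_univ i) (indicator_of_notMem hi _)).symm

/-- Replacing the last coordinate by the sum is a shear: for fixed first D coordinates it is a
translation. -/
lemma lintegral_castSucc_sum (D : ℕ) {F : (Fin D → ℝ) × ℝ → ℝ≥0∞} (hF : Measurable F) :
    ∫⁻ Y : Fin (D + 1) → ℝ, F (fun i => Y i.castSucc, ∑ j, Y j) = ∫⁻ s, ∫⁻ y, F (y, s) := by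
  have h := (volume_preserving_piFinSuccAbove (fun _ : Fin (D + 1) => ℝ) (Fin.last D)).symm
  rw [← h.lintegral_comp (by fun_prop)]
  have : ∀ z : ℝ × (Fin D → ℝ),
      F (fun i => (MeasurableEquiv.piFinSuccAbove (fun _ : Fin (D + 1) => ℝ)
        (Fin.last D)).symm z i.castSucc,
        ∑ j, (MeasurableEquiv.piFinSuccAbove (fun _ : Fin (D + 1) => ℝ)
        (Fin.last D)).symm z j) = F (z.2, z.1 + ∑ j, z.2 j) := by
    intro z
    simp [MeasurableEquiv.piFinSuccAbove, Fin.insertNthEquiv, Fin.sum_univ_castSucc,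
      Fin.insertNth_last', add_comm]
  simp_rw [this]
  rw [Measure.volume_eq_prod, lintegral_prod_symm _ (by fun_prop)]
  rw [lintegral_lintegral_swap (f := fun s y => F (y, s)) (by fun_prop)]
  exact lintegral_congr fun y => lintegral_add_right_eq_self (fun t => F (y, t)) (∑ j, y j)

lemma lintegral_eq_pow_mul_lintegral_smul (D : ℕ) {s : ℝ} (hs : 0 < s)
    {F : (Fin D → ℝ) → ℝ≥0∞} (hF : Measurable F) :
    ∫⁻ y, F y = ENNReal.ofReal (s ^ D) * ∫⁻ x, F (s • x) := by
  rw [← lintegral_map hF (measurable_const_smul s),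
    Measure.map_addHaar_smul volume hs.ne', lintegral_smul_measure, smul_eq_mul, ← mul_assoc,
    ← ENNReal.ofReal_mul (by positivity)]
  rw [Module.finrank_fin_fun, abs_of_pos (by positivity), mul_inv_cancel₀ (by positivity)]
  simp

/-! ### The simplex and the joint density of ratios and sum. -/

/-- The barycentric coordinates `(x₁, …, x_D, 1 - ∑ xᵢ)`. -/
def simplexCoord {D : ℕ} (x : Fin D → ℝ) : Fin (D + 1) → ℝ :=
  Fin.snoc (α := fun _ => ℝ) x (1 - ∑ i, x i)

@[simp]
lemma simplexCoord_castSucc {D : ℕ} (x : Fin D → ℝ) (i : Fin D) :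
    simplexCoord x i.castSucc = x i := by
  simp [simplexCoord]

@[simp]
lemma simplexCoord_last {D : ℕ} (x : Fin D → ℝ) :
    simplexCoord x (Fin.last D) = 1 - ∑ i, x i := by
  simp [simplexCoord]

lemma sum_simplexCoord {D : ℕ} (x : Fin D → ℝ) : ∑ i, simplexCoord x i = 1 := by
  simp [Fin.sum_univ_castSucc]

lemma continuous_simplexCoord {D : ℕ} (i : Fin (D + 1)) :
    Continuous fun x : Fin D → ℝ => simplexCoord x i := by
  induction i using Fin.lastCases with
  | last => simp only [simplexCoord_last]; fun_prop
  | cast i => simp only [simplexCoord_castSucc]; fun_prop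

lemma simplexCoord_of_sum_eq_one {D : ℕ} {z : Fin (D + 1) → ℝ} (hz : ∑ i, z i = 1) :
    simplexCoord (fun i : Fin D => z i.castSucc) = z := by
  rw [Fin.sum_univ_castSucc] at hz
  funext i
  induction i using Fin.lastCases with
  | last => rw [simplexCoord_last]; linarith
  | cast i => rw [simplexCoord_castSucc]

lemma mem_openSimplex_iff {D : ℕ} {x : Fin D → ℝ} :
    x ∈ openSimplex D ↔ ∀ i, 0 < simplexCoord x i := by
  constructor
  · rintro ⟨h1, h2⟩ i
    induction i using Fin.lastCases with
    | last => rw [simplexCoord_last]; linarith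
    | cast i => rw [simplexCoord_castSucc]; exact (h1 i).1
  · intro h
    have h0 : ∀ i, 0 < x i := fun i => by simpa using h i.castSucc
    have hs : ∑ i, x i < 1 := by simpa using h (Fin.last D)
    exact ⟨fun i => ⟨h0 i, (Finset.single_le_sum (fun j _ => (h0 j).le)
      (Finset.mem_univ i)).trans_lt hs⟩, hs⟩

lemma isOpen_openSimplex (D : ℕ) : IsOpen (openSimplex D) := by
  have : openSimplex D = ⋂ i, {x | 0 < simplexCoord x i} := by
    ext x
    simp [mem_openSimplex_iff]
  rw [this]
  exact isOpen_iInter_of_finite fun i => isOpen_lt continuous_const (continuous_simplexCoord i)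

/-- The density of `ncDirJoint D α lam`. -/
noncomputable def ncDirDensity (D : ℕ) (α lam : Fin (D + 1) → ℝ) (z : (Fin D → ℝ) × ℝ) : ℝ :=
  if 0 < z.2 then
    z.2 ^ D * ∏ i, ncChiSqDensity (α i) (lam i) (z.2 * simplexCoord z.1 i)
  else 0

lemma ncDirDensity_nonneg {D : ℕ} {α lam : Fin (D + 1) → ℝ} (hα : ∀ i, 0 < α i)
    (hlam : ∀ i, 0 ≤ lam i) (z : (Fin D → ℝ) × ℝ) : 0 ≤ ncDirDensity D α lam z := by
  unfold ncDirDensity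
  split_ifs with h
  · exact mul_nonneg (by positivity)
      (Finset.prod_nonneg fun i _ => ncChiSqDensity_nonneg (hα i) (hlam i) _)
  · exact le_rfl

lemma ncDirDensity_eq_zero {D : ℕ} {α lam : Fin (D + 1) → ℝ} {z : (Fin D → ℝ) × ℝ}
    (hz : z ∉ openSimplex D ×ˢ Ioi 0) : ncDirDensity D α lam z = 0 := by
  unfold ncDirDensity
  split_ifs with h
  · have : ∃ i, simplexCoord z.1 i ≤ 0 := by
      by_contra! hc
      exact hz ⟨mem_openSimplex_iff.2 hc, h⟩
    obtain ⟨i, hi⟩ := this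
    rw [Finset.prod_eq_zero (Finset.mem_univ i)
      (ncChiSqDensity_of_nonpos (mul_nonpos_of_nonneg_of_nonpos h.le hi)), mul_zero]
  · rfl

lemma ncDirDensity_pos {D : ℕ} {α lam : Fin (D + 1) → ℝ} (hα : ∀ i, 0 < α i)
    (hlam : ∀ i, 0 ≤ lam i) {z : (Fin D → ℝ) × ℝ} (hz : z ∈ openSimplex D ×ˢ Ioi 0) :
    0 < ncDirDensity D α lam z := by
  have h : 0 < z.2 := hz.2
  rw [ncDirDensity, if_pos h]
  exact mul_pos (by positivity) (Finset.prod_pos fun i _ =>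
    ncChiSqDensity_pos (hα i) (hlam i) (mul_pos h (mem_openSimplex_iff.1 hz.1 i)))

lemma continuousOn_ncDirDensity {D : ℕ} {α : Fin (D + 1) → ℝ} (hα : ∀ i, 0 < α i)
    (lam : Fin (D + 1) → ℝ) :
    ContinuousOn (ncDirDensity D α lam) (openSimplex D ×ˢ Ioi 0) := by
  have : ContinuousOn (fun z : (Fin D → ℝ) × ℝ =>
      z.2 ^ D * ∏ i, ncChiSqDensity (α i) (lam i) (z.2 * simplexCoord z.1 i))
      (openSimplex D ×ˢ Ioi 0) := by
    refine (continuous_snd.pow D).continuousOn.mul (continuousOn_finsetProd _ fun i _ => ?_)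
    refine (continuousOn_ncChiSqDensity (hα i) (lam i)).comp
      (continuous_snd.mul ((continuous_simplexCoord i).comp continuous_fst)).continuousOn ?_
    exact fun z hz => mul_pos hz.2 (mem_openSimplex_iff.1 hz.1 i)
  exact this.congr fun z hz => if_pos hz.2

lemma measurable_ncDirDensity {D : ℕ} {α : Fin (D + 1) → ℝ} (hα : ∀ i, 0 < α i)
    (lam : Fin (D + 1) → ℝ) : Measurable (ncDirDensity D α lam) := by
  refine Measurable.ite (measurableSet_lt measurable_const measurable_snd) ?_ measurable_const
  refine (measurable_snd.pow_const D).mul (Finset.measurable_prod _ fun i _ => ?_)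
  exact (measurable_ncChiSqDensity (hα i) (lam i)).comp
    (measurable_snd.mul ((continuous_simplexCoord i).measurable.comp measurable_fst))

lemma pi_ncChiSq_eq_withDensity {n : ℕ} {α lam : Fin n → ℝ} (hα : ∀ i, 0 < α i)
    (hlam : ∀ i, 0 ≤ lam i) :
    Measure.pi (fun i => ncChiSq (2 * α i) (lam i)) =
      volume.withDensity fun Y : Fin n → ℝ =>
        ENNReal.ofReal (∏ i, ncChiSqDensity (α i) (lam i) (Y i)) := by
  simp_rw [ncChiSq_eq_withDensity (hα _) (hlam _)]
  have hm : ∀ i, Measurable fun y => ENNReal.ofReal (ncChiSqDensity (α i) (lam i) y) :=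
    fun i => (measurable_ncChiSqDensity (hα i) (lam i)).ennreal_ofReal
  have : ∀ i, SigmaFinite
      (volume.withDensity fun y => ENNReal.ofReal (ncChiSqDensity (α i) (lam i) y)) := fun i =>
    SigmaFinite.withDensity_ofReal _
  rw [pi_withDensity n hm]
  congr 1
  funext Y
  rw [ENNReal.ofReal_prod_of_nonneg fun i _ => ncChiSqDensity_nonneg (hα i) (hlam i) _]

/-- The joint density in the coordinates given by the first `D` variables and the sum. -/
lemma prod_ncChiSqDensity_eq {D : ℕ} (α lam : Fin (D + 1) → ℝ) (Y : Fin (D + 1) → ℝ) :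
    ∏ i, ncChiSqDensity (α i) (lam i) (Y i) =
      (∏ i : Fin D, ncChiSqDensity (α i.castSucc) (lam i.castSucc) (Y i.castSucc)) *
        ncChiSqDensity (α (Fin.last D)) (lam (Fin.last D)) (∑ j, Y j - ∑ i : Fin D, Y i.castSucc) := by
  rw [Fin.prod_univ_castSucc, Fin.sum_univ_castSucc, add_sub_cancel_left]

/-- Two changes of variables: the shear to (first D variables, sum s), then for each s > 0 the
scaling y = s x, which yields the factor s^D. -/
lemma ncDirJoint_eq_withDensity {D : ℕ} {α lam : Fin (D + 1) → ℝ} (hα : ∀ i, 0 < α i)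
    (hlam : ∀ i, 0 ≤ lam i) :
    ncDirJoint D α lam =
      volume.withDensity fun z => ENNReal.ofReal (ncDirDensity D α lam z) := by
  set q : (Fin D → ℝ) × ℝ → ℝ := fun z =>
    (∏ i : Fin D, ncChiSqDensity (α i.castSucc) (lam i.castSucc) (z.1 i)) *
      ncChiSqDensity (α (Fin.last D)) (lam (Fin.last D)) (z.2 - ∑ i, z.1 i) with hq
  have hqm : Measurable q :=
    (Finset.measurable_prod _ fun i _ => (measurable_ncChiSqDensity (hα _) _).comp
      (by fun_prop)).mul ((measurable_ncChiSqDensity (hα _) _).comp (by fun_prop))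
  have hT : Measurable fun z : (Fin D → ℝ) × ℝ => ((fun i => z.1 i / z.2 : Fin D → ℝ), z.2) := by
    fun_prop
  ext A hA
  set F : (Fin D → ℝ) × ℝ → ℝ≥0∞ := fun z =>
    A.indicator (fun _ => ENNReal.ofReal (q z)) ((fun i => z.1 i / z.2 : Fin D → ℝ), z.2) with hF
  have hFm : Measurable F := by
    have : F = ((fun z : (Fin D → ℝ) × ℝ => ((fun i => z.1 i / z.2 : Fin D → ℝ), z.2)) ⁻¹'
        A).indicator fun z => ENNReal.ofReal (q z) := rfl
    rw [this]
    exact hqm.ennreal_ofReal.indicator (hT hA)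
  have hmap : Measurable fun Y : Fin (D + 1) → ℝ =>
      ((fun i : Fin D => Y i.castSucc / ∑ j, Y j), ∑ j, Y j) := by fun_prop
  rw [ncDirJoint, pi_ncChiSq_eq_withDensity hα hlam, Measure.map_apply hmap hA,
    withDensity_apply _ (hmap hA), ← lintegral_indicator (hmap hA), withDensity_apply _ hA,
    ← lintegral_indicator hA, Measure.volume_eq_prod, lintegral_prod_symm _
      ((measurable_ncDirDensity hα lam).ennreal_ofReal.indicator hA).aemeasurable]
  have h1 : ∀ Y : Fin (D + 1) → ℝ,
      ((fun Y : Fin (D + 1) → ℝ =>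
        ((fun i : Fin D => Y i.castSucc / ∑ j, Y j), ∑ j, Y j)) ⁻¹' A).indicator
        (fun Y => ENNReal.ofReal (∏ i, ncChiSqDensity (α i) (lam i) (Y i))) Y =
      F (fun i => Y i.castSucc, ∑ j, Y j) := fun Y => by
    simp only [prod_ncChiSqDensity_eq, hF, hq]
    rfl
  simp_rw [h1]
  rw [lintegral_castSucc_sum D hFm]
  refine lintegral_congr fun s => ?_
  rcases lt_or_ge 0 s with hs | hs
  · rw [lintegral_eq_pow_mul_lintegral_smul D hs (F := fun y => F (y, s)) (hFm.comp measurable_prodMk_right),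
      ← lintegral_const_mul _ (by fun_prop)]
    refine lintegral_congr fun x => ?_
    have h2 : (fun i => (s • x) i / s) = x := by
      funext i
      simp [mul_div_cancel_left₀ _ hs.ne']
    have h3 : s ^ D * q (s • x, s) = ncDirDensity D α lam (x, s) := by
      rw [ncDirDensity, if_pos hs, Fin.prod_univ_castSucc]
      simp only [hq, simplexCoord_castSucc, simplexCoord_last, Pi.smul_apply, smul_eq_mul,
        mul_sub, mul_one, Finset.mul_sum]
    simp only [hF, h2]
    by_cases hx : (x, s) ∈ A
    · rw [indicator_of_mem hx, indicator_of_mem hx, ← ENNReal.ofReal_mul (by positivity), h3]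
    · rw [indicator_of_notMem hx, indicator_of_notMem hx, mul_zero]
  -- For s ≤ 0 the D + 1 variables cannot all be positive, so the quotient by s plays no role.
  · have hq0 : ∀ y, q (y, s) = 0 := fun y => by
      by_cases hy : ∃ i, y i ≤ 0
      · obtain ⟨i, hi⟩ := hy
        simp only [hq]
        rw [Finset.prod_eq_zero (Finset.mem_univ i) (ncChiSqDensity_of_nonpos hi), zero_mul]
      · push Not at hy
        simp only [hq]
        rw [ncChiSqDensity_of_nonpos (a := α (Fin.last D)), mul_zero]
        linarith [Finset.sum_nonneg fun i (_ : i ∈ Finset.univ) => (hy i).le]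
    refine lintegral_congr fun y => ?_
    simp [hF, hq0, ncDirDensity, hs.not_gt, indicator]

lemma isContinuousDensity_ncDirDensity {D : ℕ} {α lam : Fin (D + 1) → ℝ} (hα : ∀ i, 0 < α i)
    (hlam : ∀ i, 0 ≤ lam i) :
    IsContinuousDensity (ncDirJoint D α lam) (openSimplex D ×ˢ Ioi 0) (ncDirDensity D α lam) where
  nonneg := ncDirDensity_nonneg hα hlam
  eq_zero _ hz := ncDirDensity_eq_zero hz
  continuousOn := continuousOn_ncDirDensity hα lam
  eq_withDensity := ncDirJoint_eq_withDensity hα hlam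

/-! ### The conditional law and its normalising constant. -/

lemma IsContinuousDensity.measurable {E : Type*} [TopologicalSpace E] [MeasureSpace E]
    [BorelSpace E] {ν : Measure E} {U : Set E} {f : E → ℝ} (hf : IsContinuousDensity ν U f)
    (hU : IsOpen U) : Measurable f := by
  classical
  have : f = U.piecewise f 0 := by
    funext z
    by_cases hz : z ∈ U
    · rw [piecewise_eq_of_mem _ _ _ hz]
    · rw [piecewise_eq_of_notMem _ _ _ hz, hf.eq_zero z hz, Pi.zero_apply]
  rw [this]
  exact hf.continuousOn.measurable_piecewise continuousOn_const hU.measurableSet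

/-- This identifies the density chosen in `condLawAt` with the explicit `ncDirDensity`. -/
lemma IsContinuousDensity.unique {E : Type*} [TopologicalSpace E] [MeasureSpace E]
    [BorelSpace E] [SigmaFinite (volume : Measure E)] [(volume : Measure E).IsOpenPosMeasure]
    {ν : Measure E} {U : Set E} {f g : E → ℝ} (hf : IsContinuousDensity ν U f)
    (hg : IsContinuousDensity ν U g) (hU : IsOpen U) : f = g := by
  have h : (fun z => ENNReal.ofReal (f z)) =ᵐ[volume] fun z => ENNReal.ofReal (g z) :=
    (withDensity_eq_iff_of_sigmaFinite (hf.measurable hU).ennreal_ofReal.aemeasurable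
      (hg.measurable hU).ennreal_ofReal.aemeasurable).1
      (hf.eq_withDensity.symm.trans hg.eq_withDensity)
  have h' : f =ᵐ[volume.restrict U] g := by
    refine ae_restrict_of_ae (h.mono fun z hz => ?_)
    rwa [ENNReal.ofReal_eq_ofReal_iff (hf.nonneg z) (hg.nonneg z)] at hz
  have heq := Measure.eqOn_open_of_ae_eq h' hU hf.continuousOn hg.continuousOn
  funext z
  by_cases hz : z ∈ U
  · exact heq hz
  · rw [hf.eq_zero z hz, hg.eq_zero z hz]

lemma cncDir_eq {D : ℕ} {α lam : Fin (D + 1) → ℝ} (hα : ∀ i, 0 < α i) (hlam : ∀ i, 0 ≤ lam i) :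
    cncDir D α lam = (∫⁻ x, ENNReal.ofReal (ncDirDensity D α lam (x, 1)))⁻¹ •
      volume.withDensity fun x => ENNReal.ofReal (ncDirDensity D α lam (x, 1)) := by
  have hf := isContinuousDensity_ncDirDensity hα hlam
  have h : ∃ f, IsContinuousDensity (ncDirJoint D α lam) (openSimplex D ×ˢ Ioi 0) f := ⟨_, hf⟩
  rw [cncDir, condLawAt, dif_pos h,
    h.choose_spec.unique hf ((isOpen_openSimplex D).prod isOpen_Ioi)]

/-- Up to a constant, a dilation increases the non-central chi-squared density on `(-∞, 1]`. -/
lemma exists_ncChiSqDensity_le_dilation {a l s : ℝ} (ha : 0 < a) (hl : 0 ≤ l) (hs : 0 < s) :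
    ∃ C, ∀ y ≤ 1, ncChiSqDensity a l y ≤ C * ncChiSqDensity a l (s * y) := by
  -- In the ratio of the two densities y^(a-1) cancels, leaving a function continuous up to y = 0
  -- and hence bounded on [0, 1].
  have h1 : ContinuousOn (fun y : ℝ => Real.exp (-(y / 2)) * besselSeries a (l / 4 * y) /
      (Real.exp (-(s * y / 2)) * s ^ (a - 1) * besselSeries a (l / 4 * (s * y)))) (Icc 0 1) := by
    have hc : ∀ k : ℝ, Continuous fun y => besselSeries a (l / 4 * (k * y)) := fun k =>
      (continuous_besselSeries ha).comp (by fun_prop)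
    refine ContinuousOn.div ?_ ?_ fun y hy => ?_
    · have := hc 1
      simp only [one_mul] at this
      fun_prop
    · have := hc s
      fun_prop
    · have hy0 := hy.1
      have := besselSeries_pos ha (show 0 ≤ l / 4 * (s * y) by positivity)
      positivity
  obtain ⟨C, hC⟩ := isCompact_Icc.bddAbove_image h1
  refine ⟨C, fun y hy => ?_⟩
  rcases le_or_gt y 0 with h0 | h0
  · rw [ncChiSqDensity_of_nonpos h0,
      ncChiSqDensity_of_nonpos (mul_nonpos_of_nonneg_of_nonpos hs.le h0), mul_zero]
  · have hb := besselSeries_pos ha (show 0 ≤ l / 4 * (s * y) by positivity)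
    have h2 := hC (mem_image_of_mem _ ⟨h0.le, hy⟩)
    rw [div_le_iff₀ (by positivity)] at h2
    rw [ncChiSqDensity_of_pos h0, ncChiSqDensity_of_pos (mul_pos hs h0),
      Real.mul_rpow hs.le h0.le]
    calc _ = Real.exp (-(l / 2)) * (1 / 2) ^ a * y ^ (a - 1) *
          (Real.exp (-(y / 2)) * besselSeries a (l / 4 * y)) := by ring
      _ ≤ Real.exp (-(l / 2)) * (1 / 2) ^ a * y ^ (a - 1) * (C * (Real.exp (-(s * y / 2)) *
          s ^ (a - 1) * besselSeries a (l / 4 * (s * y)))) := by gcongr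
      _ = _ := by ring

lemma exists_ncDirDensity_le {D : ℕ} {α lam : Fin (D + 1) → ℝ} (hα : ∀ i, 0 < α i)
    (hlam : ∀ i, 0 ≤ lam i) {s : ℝ} (hs : 0 < s) :
    ∃ C, ∀ x, ncDirDensity D α lam (x, 1) ≤ C * ncDirDensity D α lam (x, s) := by
  choose C hC using fun i => exists_ncChiSqDensity_le_dilation (hα i) (hlam i) hs
  refine ⟨(∏ i, C i) * (s ^ D)⁻¹, fun x => ?_⟩
  by_cases hx : x ∈ openSimplex D
  · rw [ncDirDensity, ncDirDensity, if_pos one_pos, if_pos hs, ← mul_assoc,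
      inv_mul_cancel_right₀ (by positivity), ← Finset.prod_mul_distrib]
    simp only [one_pow, one_mul]
    refine Finset.prod_le_prod (fun i _ => ncChiSqDensity_nonneg (hα i) (hlam i) _)
      fun i _ => hC i _ ?_
    rw [← sum_simplexCoord x]
    exact Finset.single_le_sum (fun j _ => (mem_openSimplex_iff.1 hx j).le) (Finset.mem_univ i)
  · rw [ncDirDensity_eq_zero fun h => hx h.1, ncDirDensity_eq_zero fun h => hx h.1, mul_zero]

lemma measurable_ncDirDensity_section {D : ℕ} {α : Fin (D + 1) → ℝ} (hα : ∀ i, 0 < α i)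
    (lam : Fin (D + 1) → ℝ) (s : ℝ) : Measurable fun x => ncDirDensity D α lam (x, s) :=
  (measurable_ncDirDensity hα lam).comp measurable_prodMk_right

lemma lintegral_ncDirDensity {D : ℕ} {α lam : Fin (D + 1) → ℝ} (hα : ∀ i, 0 < α i)
    (hlam : ∀ i, 0 ≤ lam i) :
    ∫⁻ s, ∫⁻ x, ENNReal.ofReal (ncDirDensity D α lam (x, s)) = 1 := by
  have : ∀ i, IsProbabilityMeasure (ncChiSq (2 * α i) (lam i)) :=
    fun i => isProbabilityMeasure_ncChiSq (hα i)
  have : IsProbabilityMeasure (ncDirJoint D α lam) :=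
    Measure.isProbabilityMeasure_map (by fun_prop)
  rw [← lintegral_prod_symm (fun z => ENNReal.ofReal (ncDirDensity D α lam z))
    (measurable_ncDirDensity hα lam).ennreal_ofReal.aemeasurable, ← Measure.volume_eq_prod,
    ← setLIntegral_univ, ← withDensity_apply _ MeasurableSet.univ,
    ← ncDirJoint_eq_withDensity hα hlam, measure_univ]

/-- The joint law has total mass 1, so the section at almost every s has finite integral; the
dilation bound carries this from one such s > 0 to s = 1. -/
lemma lintegral_ncDirDensity_one_ne_top {D : ℕ} {α lam : Fin (D + 1) → ℝ} (hα : ∀ i, 0 < α i)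
    (hlam : ∀ i, 0 ≤ lam i) : ∫⁻ x, ENNReal.ofReal (ncDirDensity D α lam (x, 1)) ≠ ∞ := by
  have hm := (measurable_ncDirDensity hα lam).ennreal_ofReal
  have hae : ∀ᵐ s, ∫⁻ x, ENNReal.ofReal (ncDirDensity D α lam (x, s)) < ∞ :=
    ae_lt_top hm.lintegral_prod_left' (by rw [lintegral_ncDirDensity hα hlam]; simp)
  obtain ⟨s, hs, hs0⟩ : ∃ s, ∫⁻ x, ENNReal.ofReal (ncDirDensity D α lam (x, s)) < ∞ ∧ 0 < s := by
    by_contra! h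
    have h0 : volume (Ioi (0 : ℝ)) = 0 := by
      refine measure_mono_null ?_ (ae_iff.1 hae)
      intro s hs h'
      exact absurd (h s h') (not_le.2 hs)
    simp at h0
  obtain ⟨C, hC⟩ := exists_ncDirDensity_le hα hlam hs0
  refine ne_top_of_le_ne_top (ENNReal.mul_ne_top (ENNReal.ofReal_ne_top (r := C)) hs.ne) ?_
  rw [← lintegral_const_mul _ (measurable_ncDirDensity_section hα lam s).ennreal_ofReal]
  refine lintegral_mono fun x => ?_
  rw [← ENNReal.ofReal_mul' (ncDirDensity_nonneg hα hlam _)]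
  exact ENNReal.ofReal_le_ofReal (hC x)

lemma nonempty_openSimplex (D : ℕ) : (openSimplex D).Nonempty := by
  have hs : ∑ _i : Fin (D + 1), 1 / ((D : ℝ) + 1) = 1 := by
    simp
    field_simp
  refine ⟨fun _ => 1 / ((D : ℝ) + 1), mem_openSimplex_iff.2 fun i => ?_⟩
  rw [simplexCoord_of_sum_eq_one (z := fun _ => 1 / ((D : ℝ) + 1)) hs]
  positivity

lemma lintegral_ncDirDensity_one_ne_zero {D : ℕ} {α lam : Fin (D + 1) → ℝ} (hα : ∀ i, 0 < α i)
    (hlam : ∀ i, 0 ≤ lam i) : ∫⁻ x, ENNReal.ofReal (ncDirDensity D α lam (x, 1)) ≠ 0 := by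
  rw [Ne, lintegral_eq_zero_iff (measurable_ncDirDensity_section hα lam 1).ennreal_ofReal]
  intro h
  refine ((isOpen_openSimplex D).measure_pos volume (nonempty_openSimplex D)).ne'
    (measure_mono_null ?_ (ae_iff.1 h))
  intro x hx hx'
  have h1 := ncDirDensity_pos hα hlam (z := (x, 1)) ⟨hx, zero_lt_one' ℝ⟩
  rw [Pi.zero_apply, ENNReal.ofReal_eq_zero] at hx'
  exact absurd h1 (not_lt.2 hx')

/-! ### Identifiability. -/

/-- Equal conditional laws have proportional densities on the simplex. -/
lemma exists_proportional_of_cncDir_eq {D : ℕ} {α α' lam lam' : Fin (D + 1) → ℝ}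
    (hα : ∀ i, 0 < α i) (hα' : ∀ i, 0 < α' i) (hlam : ∀ i, 0 ≤ lam i) (hlam' : ∀ i, 0 ≤ lam' i)
    (h : cncDir D α lam = cncDir D α' lam') :
    ∃ K, 0 < K ∧ ∀ x ∈ openSimplex D,
      ncDirDensity D α lam (x, 1) = K * ncDirDensity D α' lam' (x, 1) := by
  have key : ∀ {β μ : Fin (D + 1) → ℝ}, (∀ i, 0 < β i) → (∀ i, 0 ≤ μ i) → ∃ c, 0 < c ∧
      cncDir D β μ = volume.withDensity fun x =>
        ENNReal.ofReal (c * ncDirDensity D β μ (x, 1)) := by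
    intro β μ hβ hμ
    have h0 := lintegral_ncDirDensity_one_ne_zero hβ hμ
    have ht := lintegral_ncDirDensity_one_ne_top hβ hμ
    refine ⟨_, ENNReal.toReal_pos (ENNReal.inv_ne_zero.2 ht) (ENNReal.inv_ne_top.2 h0), ?_⟩
    rw [cncDir_eq hβ hμ, ← withDensity_smul _
      (measurable_ncDirDensity_section hβ μ 1).ennreal_ofReal]
    congr 1
    funext x
    rw [ENNReal.ofReal_mul ENNReal.toReal_nonneg, ENNReal.ofReal_toReal (ENNReal.inv_ne_top.2 h0)]
    rfl
  obtain ⟨c, hc, hceq⟩ := key hα hlam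
  obtain ⟨c', hc', hceq'⟩ := key hα' hlam'
  have hm : ∀ {β : Fin (D + 1) → ℝ} (μ : Fin (D + 1) → ℝ) (k : ℝ), (∀ i, 0 < β i) →
      Measurable fun x => ENNReal.ofReal (k * ncDirDensity D β μ (x, 1)) := fun μ k hβ =>
    ((measurable_ncDirDensity_section hβ μ 1).const_mul k).ennreal_ofReal
  have hcont : ∀ {β : Fin (D + 1) → ℝ} (μ : Fin (D + 1) → ℝ) (k : ℝ), (∀ i, 0 < β i) →
      ContinuousOn (fun x => k * ncDirDensity D β μ (x, 1)) (openSimplex D) := fun μ k hβ =>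
    continuousOn_const.mul ((continuousOn_ncDirDensity hβ μ).comp
      (Continuous.prodMk_left 1).continuousOn fun x hx => ⟨hx, zero_lt_one' ℝ⟩)
  rw [hceq, hceq', withDensity_eq_iff_of_sigmaFinite (hm lam c hα).aemeasurable
    (hm lam' c' hα').aemeasurable] at h
  have hae : (fun x => c * ncDirDensity D α lam (x, 1)) =ᵐ[volume.restrict (openSimplex D)]
      fun x => c' * ncDirDensity D α' lam' (x, 1) := by
    refine ae_restrict_of_ae (h.mono fun x hx => ?_)
    rwa [ENNReal.ofReal_eq_ofReal_iff (mul_nonneg hc.le (ncDirDensity_nonneg hα hlam _))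
      (mul_nonneg hc'.le (ncDirDensity_nonneg hα' hlam' _))] at hx
  have heq := Measure.eqOn_open_of_ae_eq hae (isOpen_openSimplex D) (hcont lam c hα)
    (hcont lam' c' hα')
  refine ⟨c' / c, by positivity, fun x hx => ?_⟩
  have := heq hx
  simp only at this
  field_simp
  linarith

lemma prod_ncChiSqDensity_proportional {D : ℕ} {α α' lam lam' : Fin (D + 1) → ℝ} {K : ℝ}
    (h : ∀ x ∈ openSimplex D, ncDirDensity D α lam (x, 1) = K * ncDirDensity D α' lam' (x, 1))
    {z : Fin (D + 1) → ℝ} (hz : ∀ i, 0 < z i) (hz1 : ∑ i, z i = 1) :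
    ∏ i, ncChiSqDensity (α i) (lam i) (z i) =
      K * ∏ i, ncChiSqDensity (α' i) (lam' i) (z i) := by
  have hc := simplexCoord_of_sum_eq_one hz1
  have := h (fun i => z i.castSucc) (mem_openSimplex_iff.2 fun i => by rw [hc]; exact hz i)
  simpa [ncDirDensity, hc] using this

lemma parameters_eq_of_proportional {D : ℕ} {α α' lam lam' : Fin (D + 1) → ℝ}
    (hα : ∀ i, 0 < α i) (hα' : ∀ i, 0 < α' i) (hlam : ∀ i, 0 ≤ lam i) (hlam' : ∀ i, 0 ≤ lam' i)
    {K : ℝ} (hK : 0 < K)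
    (h : ∀ x ∈ openSimplex D, ncDirDensity D α lam (x, 1) = K * ncDirDensity D α' lam' (x, 1))
    {i j : Fin (D + 1)} (hij : i ≠ j) : α i = α' i ∧ lam i = lam' i := by
  -- All coordinates other than i and j are frozen at their barycentre value r, which leaves 2r to
  -- share between those two.
  set r : ℝ := 1 / ((D : ℝ) + 1) with hr
  have hr0 : 0 < r := by positivity
  set S : Finset (Fin (D + 1)) := (Finset.univ.erase i).erase j with hS
  have hj : j ∈ Finset.univ.erase i := Finset.mem_erase.2 ⟨hij.symm, Finset.mem_univ j⟩
  have hSi : ∀ k ∈ S, k ≠ i ∧ k ≠ j := fun k hk =>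
    ⟨(Finset.mem_erase.1 (Finset.mem_erase.1 hk).2).1, (Finset.mem_erase.1 hk).1⟩
  have hsum : ∀ g : Fin (D + 1) → ℝ, ∑ k, g k = g i + (g j + ∑ k ∈ S, g k) := fun g => by
    rw [← Finset.add_sum_erase _ _ (Finset.mem_univ i), ← Finset.add_sum_erase _ _ hj]
  have hprod : ∀ g : Fin (D + 1) → ℝ, ∏ k, g k = g i * (g j * ∏ k ∈ S, g k) := fun g => by
    rw [← Finset.mul_prod_erase _ _ (Finset.mem_univ i), ← Finset.mul_prod_erase _ _ hj]
  have hrS : r + (r + ∑ k ∈ S, r) = 1 := by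
    rw [← hsum fun _ => r]
    simp [hr]
    field_simp
  set R : ℝ := ∏ k ∈ S, ncChiSqDensity (α k) (lam k) r with hR
  set R' : ℝ := ∏ k ∈ S, ncChiSqDensity (α' k) (lam' k) r with hR'
  have hR0 : 0 < R := Finset.prod_pos fun k _ => ncChiSqDensity_pos (hα k) (hlam k) hr0
  have hR0' : 0 < R' := Finset.prod_pos fun k _ => ncChiSqDensity_pos (hα' k) (hlam' k) hr0
  have key : ∀ t ∈ Ioo 0 (2 * r),
      ncChiSqDensity (α i) (lam i) t * (ncChiSqDensity (α j) (lam j) (2 * r - t) * R) =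
        K * (ncChiSqDensity (α' i) (lam' i) t *
          (ncChiSqDensity (α' j) (lam' j) (2 * r - t) * R')) := by
    intro t ht
    set z : Fin (D + 1) → ℝ := fun k => if k = i then t else if k = j then 2 * r - t else r with hz
    have hzi : z i = t := by simp [hz]
    have hzj : z j = 2 * r - t := by simp [hz, hij.symm]
    have hzS : ∀ k ∈ S, z k = r := fun k hk => by simp [hz, hSi k hk]
    have hz0 : ∀ k, 0 < z k := fun k => by
      simp only [hz]
      split_ifs
      exacts [ht.1, sub_pos.2 ht.2, hr0]
    have hz1 : ∑ k, z k = 1 := by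
      rw [hsum, hzi, hzj, Finset.sum_congr rfl hzS]
      linarith
    have := prod_ncChiSqDensity_proportional h hz0 hz1
    have hzR : ∀ g : Fin (D + 1) → ℝ → ℝ, ∏ k ∈ S, g k (z k) = ∏ k ∈ S, g k r := fun g =>
      Finset.prod_congr rfl fun k hk => by rw [hzS k hk]
    rwa [hprod, hprod, hzi, hzj, hzR fun k => ncChiSqDensity (α k) (lam k),
      hzR fun k => ncChiSqDensity (α' k) (lam' k)] at this
  set A : ℝ → ℝ → ℝ := fun a l => Real.exp (-(l / 2)) * (1 / 2) ^ a with hA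
  have hA0 : ∀ a l, 0 < A a l := fun a l => by positivity
  have hlam4 : ∀ i, 0 ≤ lam i / 4 := fun i => by have := hlam i; positivity
  have hlam4' : ∀ i, 0 ≤ lam' i / 4 := fun i => by have := hlam' i; positivity
  have := parameters_eq_of_two_factor (hα i) (hα' i) (hα j) (hα' j) (hlam4 i) (hlam4' i)
    (hlam4 j) (hlam4' j) (σ := 2 * r)
    (K := K * (A (α' i) (lam' i) * A (α' j) (lam' j) * R') /
      (A (α i) (lam i) * A (α j) (lam j) * R)) (by positivity)
    (div_pos (mul_pos hK (mul_pos (mul_pos (hA0 _ _) (hA0 _ _)) hR0'))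
      (mul_pos (mul_pos (hA0 _ _) (hA0 _ _)) hR0)) fun t ht => by
    have h1 := key t ht
    rw [ncChiSqDensity_of_pos ht.1, ncChiSqDensity_of_pos ht.1,
      ncChiSqDensity_of_pos (sub_pos.2 ht.2), ncChiSqDensity_of_pos (sub_pos.2 ht.2)] at h1
    rw [div_mul_eq_mul_div (K * (A (α' i) (lam' i) * A (α' j) (lam' j) * R')), eq_div_iff
      (mul_pos (mul_pos (hA0 (α i) (lam i)) (hA0 (α j) (lam j))) hR0).ne']
    -- The exponentials in t and 2r - t occur identically on both sides; the remaining constants are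
    -- absorbed in K.
    refine mul_left_cancel₀ (mul_pos (Real.exp_pos (-(t / 2)))
      (Real.exp_pos (-((2 * r - t) / 2)))).ne' ?_
    simp only [hA]
    linear_combination h1
  exact ⟨this.1, by linarith [this.2]⟩

theorem mainTheorem6 (D : ℕ) (hD : 1 ≤ D) (α α' lam lam' : Fin (D + 1) → ℝ)
    (hα : ∀ i, 0 < α i) (hα' : ∀ i, 0 < α' i)
    (hlam : ∀ i, 0 ≤ lam i) (hlam' : ∀ i, 0 ≤ lam' i) :
    cncDir D α lam = cncDir D α' lam' ↔ α = α' ∧ lam = lam' := by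
  refine ⟨fun h => ?_, by rintro ⟨rfl, rfl⟩; rfl⟩
  obtain ⟨K, hK, hprop⟩ := exists_proportional_of_cncDir_eq hα hα' hlam hlam' h
  have : Nontrivial (Fin (D + 1)) := Fin.nontrivial_iff_two_le.2 (by omega)
  have key : ∀ i, α i = α' i ∧ lam i = lam' i := fun i => by
    obtain ⟨j, hj⟩ := exists_ne i
    exact parameters_eq_of_proportional hα hα' hlam hlam' hK hprop hj.symm
  exact ⟨funext fun i => (key i).1, funext fun i => (key i).2⟩
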